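/- Let $M$ be a paracompact Hausdorff smooth manifold of dimension $n$ and let $A$ be a Weil algebra, i.e. a finite-dimensional commutative unital local real algebra whose maximal ideal $\mathfrak m$ has codimension $1$ over $\mathbb R$. Let $M^A$ be the Weil bundle: the manifold of all $\mathbb R$-algebra morphisms $\xi:C^\infty(M)\to A$ for which there is $x\in M$ with $\xi(f)-f(x)\in\mathfrak m$ for all $f\in C^\infty(M)$. Let $C^\infty(M^A,A)$ be the $A$-algebra of smooth $A$-valued functions on $M^A$, and for $f\in C^\infty(M)$ let $f^A\in C^\infty(M^A,A)$ be the function $f^A(\xi)=\xi(f)$. Let $M^A$ be an $A$-Poisson manifold with bracket $\{\,,\}_A$: the bracket $\{\,,\}_A$ is a Lie algebra structure over $A$ on $C^\infty(M^A,A)$ such that every map $ad(\varphi)=\{\varphi,\cdot\}_A$ is a derivation of the commutative algebra $C^\infty(M^A,A)$. Let $\widetilde{d_A}$ be the cohomology operator of the adjoint representation $\varphi\mapsto ad(\varphi)$: for a skew-symmetric $A$-multilinear form $\Omega$ of degree $p\ge 0$ on $C^\infty(M^A,A)$ with values in $C^\infty(M^A,A)$, $$\widetilde{d_A}\Omega(\varphi_1,\dots,\varphi_{p+1})=\sum_{i=1}^{p+1}(-1)^{i-1}\{\varphi_i,\Omega(\varphi_1,\dots,\widehat{\varphi_i},\dots,\varphi_{p+1})\}_A+\sum_{1\le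 i<j\le p+1}(-1)^{i+j}\Omega(\{\varphi_i,\varphi_j\}_A,\varphi_1,\dots,\widehat{\varphi_i},\dots,\widehat{\varphi_j},\dots,\varphi_{p+1}),$$ where a form of degree $0$ is an element of $C^\infty(M^A,A)$. Let $X$ be an $A$-linear derivation of $C^\infty(M^A,A)$ (a vector field). Call $X$ globally hamiltonian if $X=\widetilde{d_A}\varphi$ for some $\varphi\in C^\infty(M^A,A)$. Then: 1. If $X=\widetilde{d_A}\varphi$, then $X=ad(-\varphi)$, that is, $X(\psi)=\{-\varphi,\psi\}_A$ for all $\psi\in C^\infty(M^A,A)$. 2. If $X=-\widetilde{d_A}\varphi$, then $X=ad(\varphi)$, that is, $X(\psi)=\{\varphi,\psi\}_A$ for all $\psi\in C^\infty(M^A,A)$. 3. Suppose moreover that $\{\,,\}_A$ is a prolongation of a Poisson bracket $\{\,,\}$ on $C^\infty(M)$, in the sense that there are $A$-linear derivations $\widetilde{[ad(f)]^A}$ ($f\in C^\infty(M)$) and $\widetilde{\tau_\varphi}$ ($\varphi\in C^\infty(M^A,A)$) of $C^\infty(M^A,A)$ with $\widetilde{[ad(f)]^A}(g^A)=\{f,g\}^A$,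 $\widetilde{\tau_\varphi}(f^A)=-\widetilde{[ad(f)]^A}(\varphi)$ and $\{\varphi,\psi\}_A=\widetilde{\tau_\varphi}(\psi)$ for all $f,g\in C^\infty(M)$ and $\varphi,\psi\in C^\infty(M^A,A)$. Then also $X=\widetilde{\tau_{-\varphi}}$ in case 1 and $X=\widetilde{\tau_\varphi}$ in case 2. 4. $X$ is globally hamiltonian if and only if $X$ is an inner derivation of the Poisson $A$-algebra $C^\infty(M^A,A)$, i.e. $X=ad(\varphi)$ for some $\varphi\in C^\infty(M^A,A)$; in this case $X$ is also a derivation of the bracket: $X(\{\varphi,\psi\}_A)=\{X(\varphi),\psi\}_A+\{\varphi,X(\psi)\}_A$ for all $\varphi,\psi\in C^\infty(M^A,A)$. -/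

import Mathlib

open scoped Manifold ContDiff Topology

noncomputable section

namespace WeilHam

/-- A Weil algebra: a finite-dimensional commutative unital local real algebra whose
maximal ideal has codimension one over `ℝ`. -/
class IsWeilAlgebra (A : Type*) [CommRing A] [Algebra ℝ A] : Prop where
  finite : Module.Finite ℝ A
  isLocal : IsLocalRing A
  codim_one : Module.finrank ℝ (A ⧸ IsLocalRing.maximalIdeal A) = 1

attribute [instance] IsWeilAlgebra.finite IsWeilAlgebra.isLocal

/-- The algebra `C^∞(M)` of smooth real functions on an `n`-dimensional manifold. -/
abbrev SmoothFun (n : ℕ) (M : Type*) [TopologicalSpace M]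
    [ChartedSpace (EuclideanSpace ℝ (Fin n)) M] : Type _ :=
  ContMDiffMap (𝓡 n) 𝓘(ℝ, ℝ) M ℝ ∞

section Bundle

variable (n : ℕ) (M : Type*) [TopologicalSpace M] [ChartedSpace (EuclideanSpace ℝ (Fin n)) M]
  (A : Type*) [CommRing A] [Algebra ℝ A] [IsWeilAlgebra A]

/-- `ξ : C^∞(M) → A` is a near point of `x` of kind `A`: `ξ(f) - f(x) ∈ 𝔪` for all `f`. -/
def IsNearPoint (x : M) (ξ : SmoothFun n M →ₐ[ℝ] A) : Prop :=
  ∀ f : SmoothFun n M, ξ f - algebraMap ℝ A (f x) ∈ IsLocalRing.maximalIdeal A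

/-- The Weil bundle `M^A`, the union over `x ∈ M` of the sets of near points of `x`. -/
def WeilBundle : Type _ :=
  {ξ : SmoothFun n M →ₐ[ℝ] A // ∃ x : M, IsNearPoint n M A x ξ}

variable {n M A}

/-- The real generating function `ξ ↦ ℓ(ξ(f))` of the smooth structure of `M^A`. For `f` a local
coordinate and `ℓ` a coordinate form of `A`, these are the local coordinates of `M^A`. -/
def generator (f : SmoothFun n M) (l : A →ₗ[ℝ] ℝ) (ξ : WeilBundle n M A) : ℝ := l (ξ.1 f)

/-- The topology of `M^A`: the coarsest for which all the maps `ξ ↦ ξ(f)` into the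
finite-dimensional space `A` are continuous. -/
instance : TopologicalSpace (WeilBundle n M A) :=
  ⨅ (f : SmoothFun n M) (l : A →ₗ[ℝ] ℝ),
    TopologicalSpace.induced (generator f l) inferInstance

/-- Smooth real functions on `M^A`: those which near each point are a smooth function of
finitely many generating functions. Since the functions `generator f l`, with `f` running through
global smooth functions that agree near a point of `M` with the coordinates of a chart and `l`
through a basis of the dual of `A`, form a chart of `M^A` near each point above it, and all
generating functions are smooth, this is smoothness for the manifold structure of `M^A`. -/
def IsSmooth (u : WeilBundle n M A → ℝ) : Prop :=
  ∀ ξ₀ : WeilBundle n M A, ∃ (k : ℕ) (f : Fin k → SmoothFun n M) (l : Fin k → A →ₗ[ℝ] ℝ)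
    (F : (Fin k → ℝ) → ℝ), ContDiff ℝ ∞ F ∧
      ∀ᶠ ξ in 𝓝 ξ₀, u ξ = F (fun i => generator (f i) (l i) ξ)

theorem IsSmooth.const (c : ℝ) : IsSmooth (fun _ : WeilBundle n M A => c) := fun _ =>
  ⟨0, Fin.elim0, Fin.elim0, fun _ => c, contDiff_const, Filter.Eventually.of_forall fun _ => rfl⟩

theorem IsSmooth.generator (f : SmoothFun n M) (l : A →ₗ[ℝ] ℝ) :
    IsSmooth (WeilHam.generator f l) := fun _ =>
  ⟨1, fun _ => f, fun _ => l, fun v => v 0, contDiff_apply ℝ ℝ 0,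
    Filter.Eventually.of_forall fun _ => rfl⟩

theorem IsSmooth.comp₂ {u v : WeilBundle n M A → ℝ} (hu : IsSmooth u) (hv : IsSmooth v)
    {G : ℝ × ℝ → ℝ} (hG : ContDiff ℝ ∞ G) : IsSmooth (fun ξ => G (u ξ, v ξ)) := by
  intro ξ₀
  obtain ⟨k, f, l, F, hF, h⟩ := hu ξ₀
  obtain ⟨k', f', l', F', hF', h'⟩ := hv ξ₀
  refine ⟨k + k', Fin.append f f', Fin.append l l',
    fun w => G (F (fun i => w (Fin.castAdd k' i)), F' (fun i => w (Fin.natAdd k i))), ?_, ?_⟩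
  · refine hG.comp (ContDiff.prodMk (hF.comp ?_) (hF'.comp ?_)) <;>
      exact contDiff_pi.2 fun i => contDiff_apply ℝ ℝ _
  · filter_upwards [h, h'] with ξ h1 h2
    simp [h1, h2]

theorem IsSmooth.add {u v : WeilBundle n M A → ℝ} (hu : IsSmooth u) (hv : IsSmooth v) :
    IsSmooth (fun ξ => u ξ + v ξ) :=
  hu.comp₂ hv (G := fun p => p.1 + p.2) (contDiff_fst.add contDiff_snd)

theorem IsSmooth.mul {u v : WeilBundle n M A → ℝ} (hu : IsSmooth u) (hv : IsSmooth v) :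
    IsSmooth (fun ξ => u ξ * v ξ) :=
  hu.comp₂ hv (G := fun p => p.1 * p.2) (contDiff_fst.mul contDiff_snd)

theorem IsSmooth.sum {ι : Type*} (s : Finset ι) {u : ι → WeilBundle n M A → ℝ}
    (hu : ∀ i, IsSmooth (u i)) : IsSmooth (fun ξ => ∑ i ∈ s, u i ξ) := by
  classical
  induction s using Finset.induction_on with
  | empty => simpa using IsSmooth.const 0
  | insert a s ha ih =>
    simp only [Finset.sum_insert ha]
    exact (hu a).add ih

variable (n M A)

/-- The `A`-algebra `C^∞(M^A, A)` of smooth functions on `M^A` with values in `A`; a map into the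
finite-dimensional space `A` is smooth when its composites with all linear forms are. -/
def SmoothAlg : Subalgebra A (WeilBundle n M A → A) where
  carrier := {φ | ∀ l : A →ₗ[ℝ] ℝ, IsSmooth (fun ξ => l (φ ξ))}
  mul_mem' := by
    intro φ ψ hφ hψ l
    let b := Module.finBasis ℝ A
    have key : (fun ξ => l ((φ * ψ) ξ)) = fun ξ => ∑ i, ∑ j,
        (b.coord i (φ ξ) * b.coord j (ψ ξ)) * l (b i * b j) := by
      funext ξ
      have h1 := b.sum_repr (φ ξ)
      have h2 := b.sum_repr (ψ ξ)
      simp only [Pi.mul_apply]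
      conv_lhs => rw [← h1, ← h2, Finset.sum_mul_sum]
      simp [map_sum, smul_smul, mul_comm]
    rw [key]
    exact IsSmooth.sum _ fun i => IsSmooth.sum _ fun j =>
      ((hφ _).mul (hψ _)).mul (IsSmooth.const _)
  add_mem' := by
    intro φ ψ hφ hψ l
    simpa using (hφ l).add (hψ l)
  algebraMap_mem' := fun a l => IsSmooth.const (l a)

variable {n M}

/-- The prolongation `f^A ∈ C^∞(M^A, A)` of `f ∈ C^∞(M)`, `f^A(ξ) = ξ(f)`. -/
def prolong (f : SmoothFun n M) : SmoothAlg n M A :=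
  ⟨fun ξ => ξ.1 f, fun l => IsSmooth.generator f l⟩

end Bundle

section Poisson

/-- A Poisson bracket on the commutative `R`-algebra `C`: a Lie algebra structure over `R` on `C`
all of whose maps `{a, ·}` are derivations of the commutative algebra `C`. -/
structure PoissonBracket (R C : Type*) [CommRing R] [CommRing C] [Algebra R C] where
  bracket : C →ₗ[R] C →ₗ[R] C
  self : ∀ a, bracket a a = 0
  jacobi : ∀ a b c,
    bracket a (bracket b c) + bracket b (bracket c a) + bracket c (bracket a b) = 0
  leibniz : ∀ a b c, bracket a (b * c) = bracket a b * c + b * bracket a c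

variable {R C : Type*} [CommRing R] [CommRing C] [Algebra R C]

/-- The adjoint map `ad(a) = {a, ·}`, an `R`-linear derivation of `C`. -/
def PoissonBracket.ad (B : PoissonBracket R C) (a : C) : Derivation R C C :=
  Derivation.mk' (B.bracket a) fun b c => by
    rw [B.leibniz, smul_eq_mul, smul_eq_mul]; ring

/-- The cohomology operator of the adjoint representation `a ↦ ad(a)`. For an alternating
`R`-multilinear form `Ω` of degree `p`,
`(dΩ)(v₁, …, v_{p+1}) = ∑ᵢ (-1)^{i-1} ad(vᵢ)(Ω(…, v̂ᵢ, …))`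
`+ ∑_{i<j} (-1)^{i+j} Ω({vᵢ, vⱼ}, …, v̂ᵢ, …, v̂ⱼ, …)`.
Indices start at `0` in the code; the second sum is empty for `p = 0`. -/
def PoissonBracket.d (B : PoissonBracket R C) :
    {p : ℕ} → (C [⋀^Fin p]→ₗ[R] C) → (Fin (p + 1) → C) → C
  | 0, Ω, v => B.ad (v 0) (Ω Fin.elim0)
  | (q + 1), Ω, v =>
      (∑ i : Fin (q + 2), (-1) ^ (i : ℕ) * B.ad (v i) (Ω (fun k => v (i.succAbove k)))) +
      ∑ j : Fin (q + 2), ∑ i : Fin (q + 1) with i.castSucc < j,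
        (-1) ^ ((i : ℕ) + (j : ℕ)) *
          Ω (Fin.cons (B.bracket (v i.castSucc) (v j))
            (fun k : Fin q => v (j.succAbove (i.succAbove k))))

/-- `X = dφ` as forms of degree one, the element `φ ∈ C` being a form of degree zero. -/
def PoissonBracket.IsPrimitive (B : PoissonBracket R C) (φ : C) (X : Derivation R C C) : Prop :=
  ∀ v : Fin 1 → C, X (v 0) = B.d (AlternatingMap.constOfIsEmpty R C (Fin 0) φ) v

/-- `X` is globally hamiltonian: it is exact for the cohomology of the adjoint representation. -/
def PoissonBracket.IsGloballyHamiltonian (B : PoissonBracket R C) (X : Derivation R C C) : Prop :=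
  ∃ φ : C, B.IsPrimitive φ X

/-- `X` is a derivation of the Poisson algebra: besides being a derivation of the product, it is a
derivation of the bracket. -/
def PoissonBracket.IsPoissonDerivation (B : PoissonBracket R C) (X : Derivation R C C) : Prop :=
  ∀ a b, X (B.bracket a b) = B.bracket (X a) b + B.bracket a (X b)

/-- `X` is an inner derivation of the Poisson algebra. -/
def PoissonBracket.IsInner (B : PoissonBracket R C) (X : Derivation R C C) : Prop :=
  ∃ φ : C, X = B.ad φ

end Poisson

/-- The bracket `{,}_A` on `C^∞(M^A, A)` is a prolongation of the Poisson bracket `{,}` of `M`: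
there are `A`-linear derivations `adA f` with `adA f (g^A) = {f, g}^A`, and the `A`-linear
derivations `τ φ` satisfy `τ φ (f^A) = - adA f (φ)` and `{φ, ψ}_A = τ φ (ψ)`. -/
def IsProlongation {n : ℕ} {M : Type*} [TopologicalSpace M]
    [ChartedSpace (EuclideanSpace ℝ (Fin n)) M]
    {A : Type*} [CommRing A] [Algebra ℝ A] [IsWeilAlgebra A]
    (P : PoissonBracket ℝ (SmoothFun n M)) (B : PoissonBracket A (SmoothAlg n M A))
    (τ : SmoothAlg n M A → Derivation A (SmoothAlg n M A) (SmoothAlg n M A)) : Prop :=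
  ∃ adA : SmoothFun n M → Derivation A (SmoothAlg n M A) (SmoothAlg n M A),
    (∀ f g, adA f (prolong A g) = prolong A (P.bracket f g)) ∧
    (∀ φ f, τ φ (prolong A f) = -adA f φ) ∧
    (∀ φ ψ, B.bracket φ ψ = τ φ ψ)

end WeilHam

end

/-!
In degree zero the cohomology operator is `(dφ)(ψ) = {ψ, φ}`, which is `{-φ, ψ}` because the bracket
is antisymmetric. Hence `X = dφ` says exactly that `X = ad(-φ)` (`PoissonBracket.isPrimitive_iff`),
and as `φ ↦ -φ` is a bijection of the algebra, the exact derivations are the inner ones. Inner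
derivations respect the bracket by the Jacobi identity (`PoissonBracket.isPoissonDerivation_ad`).
For a prolonged bracket, `{φ, ψ}_A = τ_φ(ψ)` for all `ψ` means `ad φ = τ_φ` (`IsProlongation.ad_eq`).
All of this but the last remark holds in any Poisson algebra.
-/

namespace WeilHam

namespace PoissonBracket

variable {R C : Type*} [CommRing R] [CommRing C] [Algebra R C] (B : PoissonBracket R C)

@[simp]
theorem ad_apply (a b : C) : B.ad a b = B.bracket a b := rfl

theorem bracket_swap (a b : C) : B.bracket a b = -B.bracket b a := by
  have h := B.self (a + b)
  simp only [map_add, LinearMap.add_apply, B.self, zero_add, add_zero] at h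
  exact eq_neg_of_add_eq_zero_right h

theorem ad_neg (a : C) : B.ad (-a) = -B.ad a := by
  ext b
  simp

theorem isPrimitive_iff {φ : C} {X : Derivation R C C} : B.IsPrimitive φ X ↔ X = B.ad (-φ) := by
  have key (ψ : C) : B.bracket ψ φ = B.ad (-φ) ψ := by
    rw [B.bracket_swap ψ φ, ad_apply, map_neg, LinearMap.neg_apply]
  constructor
  · intro h
    ext ψ
    exact (h fun _ => ψ).trans (key ψ)
  · rintro rfl v
    exact (key (v 0)).symm

theorem isGloballyHamiltonian_iff_isInner {X : Derivation R C C} :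
    B.IsGloballyHamiltonian X ↔ B.IsInner X := by
  constructor
  · rintro ⟨φ, h⟩
    exact ⟨-φ, B.isPrimitive_iff.1 h⟩
  · rintro ⟨φ, h⟩
    exact ⟨-φ, B.isPrimitive_iff.2 (by rwa [neg_neg])⟩

theorem isPoissonDerivation_ad (φ : C) : B.IsPoissonDerivation (B.ad φ) := by
  intro a b
  have h := B.jacobi φ a b
  rw [B.bracket_swap b φ, map_neg, B.bracket_swap b (B.bracket φ a)] at h
  simp only [ad_apply]
  linear_combination h

end PoissonBracket

theorem IsProlongation.ad_eq {n : ℕ} {M : Type*} [TopologicalSpace M]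
    [ChartedSpace (EuclideanSpace ℝ (Fin n)) M]
    {A : Type*} [CommRing A] [Algebra ℝ A] [IsWeilAlgebra A]
    {P : PoissonBracket ℝ (SmoothFun n M)} {B : PoissonBracket A (SmoothAlg n M A)}
    {τ : SmoothAlg n M A → Derivation A (SmoothAlg n M A) (SmoothAlg n M A)}
    (h : IsProlongation P B τ) (φ : SmoothAlg n M A) : B.ad φ = τ φ := by
  obtain ⟨_, _, _, hτ⟩ := h
  exact Derivation.ext (hτ φ)

end WeilHam

open WeilHam in
theorem mainTheorem7 {n : ℕ} {M : Type*} [TopologicalSpace M]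
    [ChartedSpace (EuclideanSpace ℝ (Fin n)) M] [IsManifold (𝓡 n) ∞ M]
    [T2Space M] [ParacompactSpace M]
    {A : Type*} [CommRing A] [Algebra ℝ A] [IsWeilAlgebra A]
    (B : PoissonBracket A (SmoothAlg n M A))
    (X : Derivation A (SmoothAlg n M A) (SmoothAlg n M A)) :
    (∀ φ : SmoothAlg n M A, B.IsPrimitive φ X →
      X = B.ad (-φ) ∧ (∀ ψ, X ψ = B.bracket (-φ) ψ) ∧
      ∀ (P : PoissonBracket ℝ (SmoothFun n M))
        (τ : SmoothAlg n M A → Derivation A (SmoothAlg n M A) (SmoothAlg n M A)),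
        IsProlongation P B τ → X = τ (-φ)) ∧
    (∀ φ : SmoothAlg n M A, B.IsPrimitive φ (-X) →
      X = B.ad φ ∧ (∀ ψ, X ψ = B.bracket φ ψ) ∧
      ∀ (P : PoissonBracket ℝ (SmoothFun n M))
        (τ : SmoothAlg n M A → Derivation A (SmoothAlg n M A) (SmoothAlg n M A)),
        IsProlongation P B τ → X = τ φ) ∧
    (B.IsGloballyHamiltonian X ↔ B.IsInner X) ∧
    (B.IsGloballyHamiltonian X → B.IsPoissonDerivation X) := by
  have h₁ (φ : SmoothAlg n M A) (h : B.IsPrimitive φ X) : X = B.ad (-φ) := B.isPrimitive_iff.1 h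
  have h₂ (φ : SmoothAlg n M A) (h : B.IsPrimitive φ (-X)) : X = B.ad φ := by
    rw [← neg_inj, ← B.ad_neg]
    exact B.isPrimitive_iff.1 h
  refine ⟨fun φ h => ⟨h₁ φ h, DFunLike.congr_fun (h₁ φ h),
      fun P τ hτ => (h₁ φ h).trans (hτ.ad_eq _)⟩,
    fun φ h => ⟨h₂ φ h, DFunLike.congr_fun (h₂ φ h), fun P τ hτ => (h₂ φ h).trans (hτ.ad_eq _)⟩,
    B.isGloballyHamiltonian_iff_isInner, fun h => ?_⟩
  obtain ⟨φ, rfl⟩ := B.isGloballyHamiltonian_iff_isInner.1 h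
  exact B.isPoissonDerivation_ad φ
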